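/- Let $\mathbb{F}$ be a skew-field and let $G$ be a locally indicable group (every nontrivial finitely generated subgroup of $G$ admits an epimorphism onto $\mathbb{Z}$). Suppose that the group ring $\mathbb{F}G$ has a Hughes-free division ring $\mathcal{D}_{\mathbb{F}G}$, that is, a skew-field $\mathcal{D}_{\mathbb{F}G}$ together with a ring homomorphism $\varphi\colon \mathbb{F}G\to\mathcal{D}_{\mathbb{F}G}$ such that (1) $\mathcal{D}_{\mathbb{F}G}$ is generated as a skew-field by $\varphi(\mathbb{F}G)$; and (2) for every nontrivial finitely generated subgroup $H\leqslant G$, every normal subgroup $N\trianglelefteq H$ with $H/N\cong\mathbb{Z}$, and all $h_1,\dots,h_n\in H$ lying in pairwise distinct cosets of $N$, the sum $\langle\varphi(\mathbb{F}N)\rangle\varphi(h_1)+\cdots+\langle\varphi(\mathbb{F}N)\rangle\varphi(h_n)$ is direct, where $\langle\varphi(\mathbb{F}N)\rangle$ denotes the sub-skew-field of $\mathcal{D}_{\mathbb{F}G}$ generated by $\varphi(\mathbb{F}N)$. Let $1\to K\to G\to\mathbb{Z}\to 1$ be a short exact sequence of groups, and let $\mathcal{D}_{\mathbb{F}K}=\langle\varphi(\mathbb{F}K)\rangle\subseteq\mathcal{D}_{\mathbb{F}G}$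 be the sub-skew-field generated by $\varphi(\mathbb{F}K)$, which is a Hughes-free division ring of $\mathbb{F}K$. For $A\in\{G,K\}$ and $p\geqslant 0$ put $$b_p^{\mathcal{D}_{\mathbb{F}A}}(A)=\dim_{\mathcal{D}_{\mathbb{F}A}}\operatorname{Tor}_p^{\mathbb{F}A}(\mathbb{F},\mathcal{D}_{\mathbb{F}A})\in\{0,1,2,\dots\}\cup\{\infty\},$$ where $\mathbb{F}$ is the trivial $\mathbb{F}A$-module, $\mathcal{D}_{\mathbb{F}A}$ is a $\mathcal{D}_{\mathbb{F}A}$-$\mathbb{F}A$-bimodule via $\varphi$, and the Tor-module is the $p$-th homology of $\mathcal{D}_{\mathbb{F}A}\otimes_{\mathbb{F}A}F_\bullet$ for a projective resolution $F_\bullet\to\mathbb{F}$ by left $\mathbb{F}A$-modules. If $b_p^{\mathcal{D}_{\mathbb{F}K}}(K)<\infty$ for some $p\geqslant 0$, then $b_p^{\mathcal{D}_{\mathbb{F}G}}(G)=0$. -/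

import Mathlib

open CategoryTheory

open scoped TensorProduct

universe u v w x

noncomputable section

namespace HughesFree

/-! ### Extension of scalars along a homomorphism of not necessarily commutative rings -/

section ExtendScalars

variable {R : Type u} {D : Type w} [Ring R] [Ring D] (φ : R →+* D)

/-- The left `D`-submodule of `D ⊗_ℤ M` generated by the elements
`d φ(r) ⊗ m - d ⊗ r m`. -/
def balancing (M : Type x) [AddCommGroup M] [Module R M] : Submodule D (D ⊗[ℤ] M) :=
  Submodule.span D
    {z | ∃ (d : D) (r : R) (m : M), z = (d * φ r) ⊗ₜ[ℤ] m - d ⊗ₜ[ℤ] (r • m)}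

/-- The left `D`-module `D ⊗_R M`, where `D` is a `D`-`R`-bimodule through `φ : R → D` and
`M` is a left `R`-module. -/
abbrev BalancedTensor (M : Type x) [AddCommGroup M] [Module R M] : Type max w x :=
  (D ⊗[ℤ] M) ⧸ balancing φ M

variable {M : Type x} [AddCommGroup M] [Module R M]
variable {N : Type x} [AddCommGroup N] [Module R N]

/-- The `D`-linear map `D ⊗_ℤ M → D ⊗_ℤ N` induced by an `R`-linear map `M → N`. -/
def tensorMap (D : Type w) [Ring D] (f : M →ₗ[R] N) : (D ⊗[ℤ] M) →ₗ[D] (D ⊗[ℤ] N) :=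
  TensorProduct.AlgebraTensorModule.map LinearMap.id f.toAddMonoidHom.toIntLinearMap

@[simp]
theorem tensorMap_tmul (f : M →ₗ[R] N) (d : D) (m : M) :
    tensorMap D f (d ⊗ₜ[ℤ] m) = d ⊗ₜ[ℤ] f m := rfl

theorem balancing_le_comap (f : M →ₗ[R] N) :
    balancing φ M ≤ (balancing φ N).comap (tensorMap D f) := by
  refine Submodule.span_le.2 ?_
  rintro _ ⟨d, r, m, rfl⟩
  refine Submodule.subset_span ⟨d, r, f m, ?_⟩
  simp

/-- The `D`-linear map `D ⊗_R M → D ⊗_R N` induced by an `R`-linear map `M → N`. -/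
def balancedMap (f : M →ₗ[R] N) : BalancedTensor φ M →ₗ[D] BalancedTensor φ N :=
  Submodule.mapQ _ _ (tensorMap D f) (balancing_le_comap φ f)

theorem balanced_hom_ext {P : Type*} [AddCommGroup P] [Module D P]
    {f g : BalancedTensor φ M →ₗ[D] P}
    (h : ∀ (d : D) (m : M), f (Submodule.Quotient.mk (d ⊗ₜ[ℤ] m)) =
      g (Submodule.Quotient.mk (d ⊗ₜ[ℤ] m))) : f = g := by
  refine Submodule.linearMap_qext _ (LinearMap.ext fun z => ?_)
  induction z using TensorProduct.induction_on with
  | zero => simp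
  | tmul d m => exact h d m
  | add a b ha hb => rw [map_add, map_add, ha, hb]

@[simp]
theorem balancedMap_mk_tmul (f : M →ₗ[R] N) (d : D) (m : M) :
    balancedMap φ f (Submodule.Quotient.mk (d ⊗ₜ[ℤ] m)) =
      Submodule.Quotient.mk (d ⊗ₜ[ℤ] f m) := rfl

/-- The functor `D ⊗_R -` from left `R`-modules to left `D`-modules. -/
def tensorFunctor : ModuleCat.{x} R ⥤ ModuleCat.{max w x} D where
  obj M := ModuleCat.of D (BalancedTensor φ M)
  map f := ModuleCat.ofHom (balancedMap φ f.hom)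
  map_id M := by
    refine ModuleCat.hom_ext (balanced_hom_ext φ fun d m => ?_)
    simp
  map_comp f g := by
    refine ModuleCat.hom_ext (balanced_hom_ext φ fun d m => ?_)
    simp

instance tensorFunctor_additive : (tensorFunctor.{u, w, x} φ).Additive where
  map_add {M N f g} := by
    refine ModuleCat.hom_ext (balanced_hom_ext φ fun d m => ?_)
    change Submodule.Quotient.mk (p := balancing φ N) (d ⊗ₜ[ℤ] (f.hom m + g.hom m)) =
      Submodule.Quotient.mk (p := balancing φ N) (d ⊗ₜ[ℤ] f.hom m) +
        Submodule.Quotient.mk (p := balancing φ N) (d ⊗ₜ[ℤ] g.hom m)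
    rw [TensorProduct.tmul_add, Submodule.Quotient.mk_add]

end ExtendScalars

/-! ### Homology and Betti numbers of a group with coefficients in a skew-field -/

section Betti

variable (F : Type u) (G : Type v) [DivisionRing F] [Group G]

/-- The augmentation `F[G] → F`. -/
def augmentation : MonoidAlgebra F G →+* F :=
  MonoidAlgebra.liftNCRingHom (RingHom.id F) (1 : G →* F) fun _ _ => Commute.one_right _

/-- The trivial left `F[G]`-module `F` (lifted to the universe of `F[G]`). -/
def trivialModule : ModuleCat.{max u v} (MonoidAlgebra F G) :=
  (ModuleCat.restrictScalars (augmentation F G)).obj (ModuleCat.of F (ULift.{v} F))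

variable {F G} {D : Type w} [DivisionRing D]

/-- `H_p(G; D) = Tor_p^{F[G]}(F, D)`, as a left `D`-module: the value at the trivial module `F`
of the `p`-th left derived functor of `D ⊗_{F[G]} -`. -/
def homology (φ : MonoidAlgebra F G →+* D) (p : ℕ) : ModuleCat.{max u v w} D :=
  ((tensorFunctor.{max u v, w, max u v} φ).leftDerived p).obj (trivialModule F G)

/-- The `p`-th Betti number `dim_D H_p(G; D)`, a natural number or `∞`. -/
def betti (φ : MonoidAlgebra F G →+* D) (p : ℕ) : ℕ∞ :=
  Cardinal.toENat (Module.rank D (homology φ p))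

end Betti

/-! ### Hughes-free division rings -/

/-- A group is locally indicable if each of its nontrivial finitely generated subgroups admits
an epimorphism onto `ℤ`. -/
def LocallyIndicable (G : Type v) [Group G] : Prop :=
  ∀ H : Subgroup G, H.FG → H ≠ ⊥ →
    ∃ f : H →* Multiplicative ℤ, Function.Surjective f

section Generated

variable {R : Type u} {D : Type w} [Ring R] [DivisionRing D]

/-- The sub-skew-field `⟨φ(R)⟩` of `D` generated by the image of `φ : R → D`. -/
def generated (φ : R →+* D) : Subfield D :=
  Subfield.closure (Set.range φ)

/-- The homomorphism `φ : R → D`, regarded as a map to `⟨φ(R)⟩`. -/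
def toGenerated (φ : R →+* D) : R →+* generated φ :=
  φ.codRestrict (generated φ) fun r => Subfield.subset_closure ⟨r, rfl⟩

end Generated

section HughesFree

variable {F : Type u} {G : Type v} {D : Type w} [DivisionRing F] [Group G] [DivisionRing D]

/-- The restriction of `φ : F[G] → D` along a group homomorphism `K → G`. -/
def restrict (φ : MonoidAlgebra F G →+* D) {K : Type x} [Group K] (ι : K →* G) :
    MonoidAlgebra F K →+* D :=
  φ.comp (MonoidAlgebra.mapDomainRingHom F ι)

/-- The pair `(D, φ)` is Hughes-free: `D` is generated by `φ(F[G])` as a skew-field, and for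
every nontrivial finitely generated subgroup `H`, every normal subgroup `N` of `H` with `H/N`
infinite cyclic, and all `h₁, …, hₙ` in `H` lying in pairwise distinct cosets of `N`, the sum
`⟨φ(F[N])⟩ φ(h₁) + ⋯ + ⟨φ(F[N])⟩ φ(hₙ)` is direct. -/
structure IsHughesFree (φ : MonoidAlgebra F G →+* D) : Prop where
  generated_eq_top : generated φ = ⊤
  direct : ∀ H : Subgroup G, H.FG → H ≠ ⊥ →
    ∀ (N : Subgroup H) [N.Normal], Nonempty (H ⧸ N ≃* Multiplicative ℤ) →
    ∀ (n : ℕ) (h : Fin n → H), Function.Injective (fun i => (h i : H ⧸ N)) →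
    ∀ a : Fin n → D, (∀ i, a i ∈ generated (restrict φ (H.subtype.comp N.subtype))) →
      ∑ i, a i * φ (MonoidAlgebra.of F G (h i)) = 0 →
      ∀ i, a i * φ (MonoidAlgebra.of F G (h i)) = 0

theorem map_generated {R : Type*} [Ring R] {E : Type*} [DivisionRing E] (ψ : R →+* D)
    (f : D →+* E) : (generated ψ).map f = generated (f.comp ψ) := by
  rw [generated, generated, RingHom.map_field_closure, RingHom.coe_comp, Set.range_comp]

/-- If `(D, φ)` is Hughes-free and `K` embeds into `G`, then the sub-skew-field of `D` generated
by `φ(F[K])` is a Hughes-free division ring of `F[K]`. -/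
theorem IsHughesFree.restrict {φ : MonoidAlgebra F G →+* D} (hφ : IsHughesFree φ)
    {K : Type x} [Group K] (ι : K →* G) (hι : Function.Injective ι) :
    IsHughesFree (toGenerated (restrict φ ι)) := by
  set ψ := HughesFree.restrict φ ι with hψ
  have hsub : (generated ψ).subtype.comp (toGenerated ψ) = ψ := rfl
  refine ⟨?_, ?_⟩
  · rw [eq_top_iff]
    rintro ⟨d, hd⟩ -
    have h2 : d ∈ (generated (toGenerated ψ)).map (generated ψ).subtype := by
      rw [map_generated, hsub]; exact hd
    obtain ⟨y, hy, rfl⟩ := h2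
    exact hy
  · intro H hH hne N hN hZ n h hinj a ha hsum i
    obtain ⟨q⟩ := hZ
    let e : H ≃* H.map ι := H.equivMapOfInjective ι hι
    let N' : Subgroup (H.map ι) := N.map e.toMonoidHom
    have hN' : N'.Normal := hN.map e.toMonoidHom e.surjective
    let c : H ⧸ N ≃* H.map ι ⧸ N' := QuotientGroup.congr N N' e rfl
    have hof : ∀ i, φ (MonoidAlgebra.of F G (e (h i))) =
        (toGenerated ψ (MonoidAlgebra.of F K (h i)) : D) := by
      intro i
      change _ = φ (MonoidAlgebra.mapDomainRingHom F ι (MonoidAlgebra.of F K (h i)))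
      simp [e]
    have hfg : (H.map ι).FG := by
      classical
      obtain ⟨S, rfl⟩ := hH
      exact ⟨S.image ι, by rw [Finset.coe_image, MonoidHom.map_closure]⟩
    have key := hφ.direct (H.map ι) hfg (by
        rw [Ne, Subgroup.map_eq_bot_iff_of_injective _ hι]; exact hne) N' ⟨c.symm.trans q⟩ n
      (fun i => e (h i)) (by
        intro i j hij
        exact hinj (c.injective hij))
      (fun i => (a i : D)) (by
        intro i
        have h1 : (a i : D) ∈ (generated (HughesFree.restrict (toGenerated ψ)
            (H.subtype.comp N.subtype))).map (generated ψ).subtype := ⟨a i, ha i, rfl⟩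
        rw [map_generated] at h1
        refine Subfield.closure_mono ?_ h1
        rintro _ ⟨z, rfl⟩
        let eN : N →* N' := (e.toMonoidHom.comp N.subtype).codRestrict N'
          fun y => ⟨y, y.2, rfl⟩
        refine ⟨MonoidAlgebra.mapDomainRingHom F eN z, ?_⟩
        change φ _ = φ _
        congr 1
        change ((MonoidAlgebra.mapDomainRingHom F ((H.map ι).subtype.comp N'.subtype)).comp
          (MonoidAlgebra.mapDomainRingHom F eN)) z = ((MonoidAlgebra.mapDomainRingHom F ι).comp
            (MonoidAlgebra.mapDomainRingHom F (H.subtype.comp N.subtype))) z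
        rw [← MonoidAlgebra.mapDomainRingHom_comp, ← MonoidAlgebra.mapDomainRingHom_comp]
        rfl) (by
        have := congrArg (generated ψ).subtype hsum
        rw [map_sum, map_zero] at this
        rw [← this]
        exact Finset.sum_congr rfl fun i _ => by rw [hof]; rfl) i
    apply Subtype.ext
    rw [hof] at key
    exact key

end HughesFree

end HughesFree

end

/-!
Write `E = ⟨φ(F[K])⟩`, let `t` lift a generator of `ℤ`, and put `τ = φ(t)`. The skew polynomials
`∑ eᵢ τⁱ` over `E` satisfy the left Ore condition, by counting dimensions over `E`, and `D` is
their skew-field of left fractions.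

Let `F_•` be a projective resolution of the trivial `F[G]`-module. It is also one over `F[K]`, and
the Hughes-free condition makes `E ⊗_{F[K]} F_• → D ⊗_{F[G]} F_•` injective. Clearing denominators,
a cycle of `D ⊗_{F[G]} F_p` becomes, after left multiplication by a nonzero `a`, a cycle `z` of
`E ⊗_{F[K]} F_p`. All `τⁱ z` are again cycles of that subcomplex, so when `H_p(K; E)` has finite
dimension some nonzero polynomial `q = ∑ eᵢ τⁱ` makes `q z` a boundary. Dividing by `q a` shows
that the original cycle is a boundary.
-/

noncomputable section

namespace HughesFree

section Ore

/-- The left Ore condition: every left fraction `a b⁻¹` can be rewritten as `c⁻¹ d`. -/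
def IsLeftOre (A : Type*) [Ring A] : Prop :=
  ∀ a b : A, b ≠ 0 → ∃ c d : A, c ≠ 0 ∧ c * a = d * b

variable {D V : Type*} [DivisionRing D] [AddCommGroup V] [Module D V]
  {A : Subring D} {L : Submodule A V}

/-- The vector `v` of a space over the skew-field `D` is of the form `a⁻¹ l` with `l ∈ L` and
`a` in the subring `A` of `D`. -/
def HasDenominator (L : Submodule A V) (v : V) : Prop :=
  ∃ a : A, a ≠ 0 ∧ a • v ∈ L

theorem HasDenominator.of_mem {v : V} (hv : v ∈ L) : HasDenominator L v :=
  ⟨1, one_ne_zero, by rwa [one_smul]⟩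

theorem HasDenominator.add (hA : IsLeftOre A) {v w : V} (hv : HasDenominator L v)
    (hw : HasDenominator L w) : HasDenominator L (v + w) := by
  obtain ⟨a, ha, hav⟩ := hv
  obtain ⟨b, hb, hbw⟩ := hw
  obtain ⟨c, d, hc, hcd⟩ := hA a b hb
  refine ⟨c * a, mul_ne_zero hc ha, ?_⟩
  rw [smul_add, mul_smul c a v, hcd, mul_smul]
  exact L.add_mem (L.smul_mem c hav) (L.smul_mem d hbw)

theorem HasDenominator.smul (hA : IsLeftOre A) {d : D} {v : V}
    (hd : HasDenominator (Submodule.span A {(1 : D)}) d) (hv : HasDenominator L v) :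
    HasDenominator L (d • v) := by
  obtain ⟨a, ha, had⟩ := hd
  obtain ⟨n, hn⟩ := Submodule.mem_span_singleton.1 had
  obtain ⟨b, hb, hbv⟩ := hv
  obtain ⟨c, m, hc, hcm⟩ := hA n b hb
  refine ⟨c * a, mul_ne_zero hc ha, ?_⟩
  have hcad : (c * a) • d • v = m • b • v := by
    rw [← smul_assoc, mul_smul, ← hn, smul_smul, hcm, smul_assoc, one_smul, mul_smul]
  rw [hcad]
  exact L.smul_mem m hbv

/-- The skew-field of left fractions `a⁻¹ b` with `a` and `b` in a left Ore subring of a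
skew-field. -/
def IsLeftOre.fractions (hA : IsLeftOre A) : Subfield D where
  carrier := {d | HasDenominator (Submodule.span A {(1 : D)}) d}
  mul_mem' := HasDenominator.smul hA
  one_mem' := .of_mem (Submodule.mem_span_singleton_self 1)
  add_mem' := HasDenominator.add hA
  zero_mem' := .of_mem (Submodule.zero_mem _)
  neg_mem' := by
    rintro d ⟨a, ha, had⟩
    exact ⟨a, ha, by rw [smul_neg]; exact Submodule.neg_mem _ had⟩
  inv_mem' := by
    rintro d ⟨a, ha, had⟩
    obtain ⟨b, hb⟩ := Submodule.mem_span_singleton.1 had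
    obtain rfl | hd := eq_or_ne d 0
    · exact .of_mem (by rw [inv_zero]; exact Submodule.zero_mem _)
    have hbd : (b : D) = a * d := by simpa [Subring.smul_def] using hb
    refine ⟨b, fun hb0 => ?_, Submodule.mem_span_singleton.2 ⟨a, ?_⟩⟩
    · rw [hb0, ZeroMemClass.coe_zero] at hbd
      exact mul_ne_zero (fun h => ha (Subtype.ext h)) hd hbd.symm
    · rw [Subring.smul_def, Subring.smul_def, smul_eq_mul, smul_eq_mul, hbd, mul_one,
        mul_inv_cancel_right₀ hd]

theorem IsLeftOre.hasDenominator (hA : IsLeftOre A)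
    (hgen : Subfield.closure (A : Set D) = ⊤) (hL : Submodule.span D (L : Set V) = ⊤) (v : V) :
    HasDenominator L v := by
  have hD (d : D) : HasDenominator (Submodule.span A {(1 : D)}) d := by
    have hle : Subfield.closure (A : Set D) ≤ hA.fractions := Subfield.closure_le.2 fun a ha =>
      .of_mem (Submodule.mem_span_singleton.2 ⟨⟨a, ha⟩, mul_one a⟩)
    exact hle (hgen ▸ Subfield.mem_top d)
  have hv : v ∈ Submodule.span D (L : Set V) := hL ▸ Submodule.mem_top
  induction hv using Submodule.span_induction with
  | mem v hv => exact .of_mem hv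
  | zero => exact .of_mem L.zero_mem
  | add v w _ _ hv hw => exact hv.add hA hw
  | smul d v _ hv => exact (hD d).smul hA hv

end Ore

section SkewPolynomials

variable {D V : Type*} [DivisionRing D] [AddCommGroup V] [Module D V] {E : Subfield D} {τ : D}

/-- The inclusion `τ E ⊆ E τ`, which allows scalars from `E` to be moved to the left of `τ`. -/
def SkewCommutes (E : Subfield D) (τ : D) : Prop :=
  ∀ e ∈ E, ∃ e' ∈ E, τ * e = e' * τ

theorem SkewCommutes.pow (hτ : SkewCommutes E τ) (n : ℕ) : SkewCommutes E (τ ^ n) := by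
  induction n with
  | zero => exact fun e he => ⟨e, he, by rw [pow_zero, one_mul, mul_one]⟩
  | succ n ih =>
    intro e he
    obtain ⟨e₁, he₁, h₁⟩ := hτ e he
    obtain ⟨e₂, he₂, h₂⟩ := ih e₁ he₁
    exact ⟨e₂, he₂, by rw [pow_succ, mul_assoc, h₁, ← mul_assoc, h₂, mul_assoc]⟩

theorem SkewCommutes.smul_mem_span (hτ : SkewCommutes E τ) {X : Set V} {L : Submodule E V}
    (h : ∀ v ∈ X, τ • v ∈ L) {v : V} (hv : v ∈ Submodule.span E X) : τ • v ∈ L := by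
  induction hv using Submodule.span_induction with
  | mem v hv => exact h v hv
  | zero => rw [smul_zero]; exact L.zero_mem
  | add v w _ _ hv hw => rw [smul_add]; exact L.add_mem hv hw
  | smul e v _ hv =>
    obtain ⟨e', he', hee'⟩ := hτ e e.2
    have : τ • e • v = (⟨e', he'⟩ : E) • τ • v := by
      rw [Subfield.smul_def, Subfield.smul_def, smul_smul, smul_smul, hee']
    rw [this]
    exact L.smul_mem _ hv

theorem smul_mem_of_mem_span_pow {L : Submodule E V} (hL : ∀ v ∈ L, τ • v ∈ L) {d : D}
    (hd : d ∈ Submodule.span E (Set.range fun n : ℕ => τ ^ n)) {v : V} (hv : v ∈ L) :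
    d • v ∈ L := by
  induction hd using Submodule.span_induction with
  | mem d hd =>
    obtain ⟨n, rfl⟩ := hd
    beta_reduce
    induction n with
    | zero => rwa [pow_zero, one_smul]
    | succ n ih => rw [pow_succ', mul_smul]; exact hL _ ih
  | zero => rw [zero_smul]; exact L.zero_mem
  | add d d' _ _ hd hd' => rw [add_smul]; exact L.add_mem hd hd'
  | smul e d _ hd => rw [smul_assoc]; exact L.smul_mem e hd

theorem SkewCommutes.smul_mem_span_pow (hτ : SkewCommutes E τ) {d : D}
    (hd : d ∈ Submodule.span E (Set.range fun n : ℕ => τ ^ n)) :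
    τ • d ∈ Submodule.span E (Set.range fun n : ℕ => τ ^ n) := by
  refine hτ.smul_mem_span ?_ hd
  rintro _ ⟨n, rfl⟩
  exact Submodule.subset_span ⟨n + 1, pow_succ' τ n⟩

/-- The ring of skew polynomials `∑ eᵢ τ ^ i` with left coefficients `eᵢ ∈ E`. -/
def SkewCommutes.polynomials (hτ : SkewCommutes E τ) : Subring D where
  carrier := Submodule.span E (Set.range fun n : ℕ => τ ^ n)
  mul_mem' ha hb := smul_mem_of_mem_span_pow (fun _ => hτ.smul_mem_span_pow) ha hb
  one_mem' := Submodule.subset_span ⟨0, pow_zero τ⟩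
  add_mem' := Submodule.add_mem _
  zero_mem' := Submodule.zero_mem _
  neg_mem' := Submodule.neg_mem _

theorem SkewCommutes.closure_polynomials (hτ : SkewCommutes E τ)
    (hgen : Subfield.closure (insert τ (E : Set D)) = ⊤) :
    Subfield.closure (hτ.polynomials : Set D) = ⊤ := by
  rw [eq_top_iff, ← hgen]
  refine Subfield.closure_mono (Set.insert_subset ?_ fun e he => ?_)
  · exact Submodule.subset_span ⟨1, pow_one τ⟩
  · have := Submodule.smul_mem _ (⟨e, he⟩ : E) hτ.polynomials.one_mem
    rwa [Subfield.smul_def, smul_eq_mul, mul_one] at this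

variable (E τ) in
/-- The space of skew polynomials `∑ eᵢ τ ^ i` of degree at most `n`. -/
def polynomialsLE (n : ℕ) : Submodule E D :=
  Submodule.span E ((fun i : ℕ => τ ^ i) '' Set.Iic n)

instance (n : ℕ) : Module.Finite E (polynomialsLE E τ n) :=
  Module.Finite.span_of_finite E ((Set.finite_Iic n).image _)

theorem polynomialsLE_mono : Monotone (polynomialsLE E τ) := fun _ _ h =>
  Submodule.span_mono (Set.image_mono (Set.Iic_subset_Iic.2 h))

theorem finrank_polynomialsLE (hind : LinearIndependent E fun n : ℕ => τ ^ n) (n : ℕ) :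
    Module.finrank E (polynomialsLE E τ n) = n + 1 := by
  have h := finrank_span_eq_card (hind.comp ((↑) : Set.Iic n → ℕ) Subtype.val_injective)
  rwa [Set.range_comp, Subtype.range_coe, ← Nat.card_eq_fintype_card, Nat.card_eq_card_toFinset,
    Set.toFinset_Iic, Nat.card_Iic] at h

theorem SkewCommutes.exists_mem_polynomialsLE (hτ : SkewCommutes E τ) {d : D}
    (hd : d ∈ hτ.polynomials) : ∃ n, d ∈ polynomialsLE E τ n := by
  have hle : Submodule.span E (Set.range fun n : ℕ => τ ^ n) ≤ ⨆ n, polynomialsLE E τ n := by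
    rw [Submodule.span_le]
    rintro _ ⟨n, rfl⟩
    exact Submodule.mem_iSup_of_mem n (Submodule.subset_span ⟨n, Set.self_mem_Iic, rfl⟩)
  exact (Submodule.mem_iSup_of_directed _ polynomialsLE_mono.directed_le).1 (hle hd)

theorem SkewCommutes.mul_mem_polynomialsLE (hτ : SkewCommutes E τ) {m n : ℕ} {a b : D}
    (ha : a ∈ polynomialsLE E τ m) (hb : b ∈ polynomialsLE E τ n) :
    a * b ∈ polynomialsLE E τ (m + n) := by
  induction ha using Submodule.span_induction with
  | mem a ha =>
    obtain ⟨i, hi, rfl⟩ := ha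
    refine (hτ.pow i).smul_mem_span ?_ hb
    rintro _ ⟨j, hj, rfl⟩
    exact Submodule.subset_span ⟨i + j, Set.mem_Iic.2 (add_le_add hi hj), pow_add τ i j⟩
  | zero => rw [zero_mul]; exact Submodule.zero_mem _
  | add a a' _ _ ha ha' => rw [add_mul]; exact Submodule.add_mem _ ha ha'
  | smul e a _ ha => rw [smul_mul_assoc]; exact Submodule.smul_mem _ e ha

/-- Right multiplication by a skew polynomial of degree at most `n`. -/
def SkewCommutes.mulRight (hτ : SkewCommutes E τ) {n : ℕ} (m : ℕ) {a : D}
    (ha : a ∈ polynomialsLE E τ n) : polynomialsLE E τ m →ₗ[E] polynomialsLE E τ (m + n) :=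
  ((LinearMap.toSpanSingleton D D a).restrictScalars E).restrict fun _ hx =>
    hτ.mul_mem_polynomialsLE hx ha

/-- The map `(x, y) ↦ x * a - y * b` on pairs of skew polynomials of degree at most `n` goes from
dimension `2 * n + 2` to dimension `2 * n + 1`, so it has a nontrivial kernel. -/
theorem SkewCommutes.isLeftOre_polynomials (hτ : SkewCommutes E τ)
    (hind : LinearIndependent E fun n : ℕ => τ ^ n) : IsLeftOre hτ.polynomials := by
  rintro ⟨a, ha⟩ ⟨b, hb⟩ hb0
  obtain ⟨m, ha⟩ := hτ.exists_mem_polynomialsLE ha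
  obtain ⟨n, hb⟩ := hτ.exists_mem_polynomialsLE hb
  have ha := polynomialsLE_mono (le_max_left m n) ha
  have hb := polynomialsLE_mono (le_max_right m n) hb
  set N := max m n
  have hker := LinearMap.ker_ne_bot_of_finrank_lt
    (f := (hτ.mulRight N ha).coprod (-hτ.mulRight N hb)) (by
      rw [Module.finrank_prod, finrank_polynomialsLE hind, finrank_polynomialsLE hind]; omega)
  obtain ⟨⟨c, d⟩, hcd, hne⟩ := (Submodule.ne_bot_iff _).1 hker
  have hmul : (c : D) * a = d * b := by
    have := congrArg Subtype.val (LinearMap.mem_ker.1 hcd)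
    exact add_neg_eq_zero.1 this
  have hmem {k : ℕ} (x : polynomialsLE E τ k) : (x : D) ∈ hτ.polynomials :=
    Submodule.span_mono (Set.image_subset_range _ _) x.2
  refine ⟨⟨c, hmem c⟩, ⟨d, hmem d⟩, fun hc => hne ?_, Subtype.ext hmul⟩
  have hc : (c : D) = 0 := congrArg Subtype.val hc
  have hd : (d : D) = 0 := by
    rw [hc, zero_mul, eq_comm] at hmul
    exact (mul_eq_zero.1 hmul).resolve_right fun h => hb0 (Subtype.ext h)
  exact Prod.ext (Subtype.ext hc) (Subtype.ext hd)

end SkewPolynomials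

section SkewLaurent

variable {D V : Type*} [DivisionRing D] [AddCommGroup V] [Module D V] {E : Subfield D} {τ : D}

variable (E τ) in
/-- The skew-field `D` is the Ore field of fractions of the ring of skew Laurent polynomials in
`τ` with coefficients in `E`. -/
structure IsSkewLaurentFractionField : Prop where
  skewCommutes : SkewCommutes E τ
  linearIndependent_zpow : LinearIndependent E fun n : ℤ => τ ^ n
  closure_eq_top : Subfield.closure (insert τ (E : Set D)) = ⊤

theorem IsSkewLaurentFractionField.linearIndependent_pow (h : IsSkewLaurentFractionField E τ) :
    LinearIndependent E fun n : ℕ => τ ^ n := by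
  simpa only [Function.comp_def, zpow_natCast] using
    h.linearIndependent_zpow.comp ((↑) : ℕ → ℤ) Nat.cast_injective

theorem IsSkewLaurentFractionField.exists_smul_mem (h : IsSkewLaurentFractionField E τ)
    {L : Submodule E V} (hτL : ∀ v ∈ L, τ • v ∈ L) (hL : Submodule.span D (L : Set V) = ⊤)
    (v : V) : ∃ a : D, a ≠ 0 ∧ a • v ∈ L := by
  let L' : Submodule h.skewCommutes.polynomials V :=
    { L with smul_mem' := fun a _ hv => smul_mem_of_mem_span_pow hτL a.2 hv }
  obtain ⟨a, ha, hav⟩ :=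
    (h.skewCommutes.isLeftOre_polynomials h.linearIndependent_pow).hasDenominator (L := L')
      (h.skewCommutes.closure_polynomials h.closure_eq_top) hL v
  exact ⟨a, fun h0 => ha (Subtype.ext h0), hav⟩

end SkewLaurent

section BalancedTensor

variable {R : Type u} {D : Type w} [Ring R] [Ring D] (φ : R →+* D)
  {M N : Type x} [AddCommGroup M] [Module R M] [AddCommGroup N] [Module R N]
  {V : Type*} [AddCommGroup V] [Module D V]

variable (M) in
/-- The additive map `m ↦ 1 ⊗ m` from `M` to `D ⊗_R M`. -/
def oneTmul : M →+ BalancedTensor φ M :=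
  AddMonoidHom.mk' (fun m => Submodule.Quotient.mk (1 ⊗ₜ[ℤ] m)) fun m n => by
    rw [TensorProduct.tmul_add, Submodule.Quotient.mk_add]

theorem mk_tmul_eq_smul_oneTmul (d : D) (m : M) :
    (Submodule.Quotient.mk (d ⊗ₜ[ℤ] m) : BalancedTensor φ M) = d • oneTmul φ M m := by
  change _ = Submodule.Quotient.mk ((d * 1) ⊗ₜ[ℤ] m)
  rw [mul_one]

theorem oneTmul_smul (r : R) (m : M) : oneTmul φ M (r • m) = φ r • oneTmul φ M m := by
  rw [← mk_tmul_eq_smul_oneTmul, eq_comm]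
  exact (Submodule.Quotient.eq _).2 (Submodule.subset_span ⟨1, r, m, by rw [one_mul]⟩)

theorem balancedMap_oneTmul (f : M →ₗ[R] N) (m : M) :
    balancedMap φ f (oneTmul φ M m) = oneTmul φ N (f m) :=
  rfl

theorem balanced_hom_ext_oneTmul {f g : BalancedTensor φ M →ₗ[D] V}
    (h : ∀ m : M, f (oneTmul φ M m) = g (oneTmul φ M m)) : f = g :=
  balanced_hom_ext φ fun d m => by
    rw [mk_tmul_eq_smul_oneTmul, map_smul, map_smul, h]

theorem span_oneTmul_eq_top {I : Type*} {c : I → M}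
    (hc : Submodule.span R (Set.range c) = ⊤) :
    Submodule.span D (Set.range fun i => oneTmul φ M (c i)) = ⊤ := by
  set P := Submodule.span D (Set.range fun i => oneTmul φ M (c i))
  have hP (m : M) : oneTmul φ M m ∈ P := by
    have hm : m ∈ Submodule.span R (Set.range c) := hc ▸ Submodule.mem_top
    induction hm using Submodule.span_induction with
    | mem m hm => obtain ⟨i, rfl⟩ := hm; exact Submodule.subset_span ⟨i, rfl⟩
    | zero => rw [map_zero]; exact P.zero_mem
    | add m n _ _ hm hn => rw [map_add]; exact P.add_mem hm hn
    | smul r m _ hm => rw [oneTmul_smul]; exact P.smul_mem _ hm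
  rw [← P.ker_mkQ, LinearMap.ker_eq_top]
  exact balanced_hom_ext_oneTmul φ fun m => (Submodule.Quotient.mk_eq_zero P).2 (hP m)

theorem span_range_oneTmul : Submodule.span D (Set.range (oneTmul φ M)) = ⊤ :=
  span_oneTmul_eq_top φ (c := id) (by rw [Set.range_id, Submodule.span_univ])

/-- The `D`-linear map `D ⊗_R M → V` with `d ⊗ m ↦ d • g m`, for a map `g` which is semilinear
along `φ`. -/
def balancedLift (g : M →+ V) (hg : ∀ (r : R) (m : M), g (r • m) = φ r • g m) :
    BalancedTensor φ M →ₗ[D] V :=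
  Submodule.liftQ _
    (TensorProduct.AlgebraTensorModule.lift
      (LinearMap.toSpanSingleton D (M →ₗ[ℤ] V) g.toIntLinearMap)) <| by
    refine Submodule.span_le.2 ?_
    rintro _ ⟨d, r, m, rfl⟩
    simp [hg, mul_smul]

theorem balancedLift_oneTmul (g : M →+ V) (hg : ∀ (r : R) (m : M), g (r • m) = φ r • g m)
    (m : M) : balancedLift φ g hg (oneTmul φ M m) = g m :=
  one_smul D (g m)

theorem linearIndependent_oneTmul {I : Type*} (c : Module.Basis I R M) :
    LinearIndependent D fun i => oneTmul φ M (c i) := by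
  let coords : BalancedTensor φ M →ₗ[D] I →₀ D := balancedLift φ
    ((Finsupp.mapRange.addMonoidHom φ.toAddMonoidHom).comp c.repr.toAddEquiv.toAddMonoidHom)
    fun r m => by ext i; simp
  have hcoords : coords ∘ (fun i => oneTmul φ M (c i)) = fun i => Finsupp.single i 1 :=
    funext fun i => (balancedLift_oneTmul φ _ _ (c i)).trans <| by simp
  exact LinearIndependent.of_comp coords (hcoords ▸ Finsupp.linearIndependent_single_one D I)

end BalancedTensor

section Comparison

variable {R : Type u} {S : Type v} {D : Type w} [Ring R] [Ring S] [DivisionRing D] [Module R S]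
  {E : Subfield D} (φ : S →+* D) (ψ : R →+* E) (hψ : ∀ r : R, (ψ r : D) = φ (r • (1 : S)))

/-- The `E`-linear map `E ⊗_R M → D ⊗_S M` with `e ⊗ m ↦ e ⊗ m`. -/
def comparison (M : Type x) [AddCommGroup M] [Module S M] [Module R M] [IsScalarTower R S M] :
    BalancedTensor ψ M →ₗ[E] BalancedTensor φ M :=
  balancedLift ψ (oneTmul φ M) fun r m => by
    rw [Subfield.smul_def, hψ, ← oneTmul_smul, smul_one_smul]

variable {M N : Type x} [AddCommGroup M] [Module S M] [Module R M] [IsScalarTower R S M]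
  [AddCommGroup N] [Module S N] [Module R N] [IsScalarTower R S N]

theorem comparison_oneTmul (m : M) :
    comparison φ ψ hψ M (oneTmul ψ M m) = oneTmul φ M m :=
  balancedLift_oneTmul ψ _ _ m

theorem comparison_balancedMap (f : M →ₗ[S] N) (y : BalancedTensor ψ M) :
    comparison φ ψ hψ N (balancedMap ψ (f.restrictScalars R) y) =
      balancedMap φ f (comparison φ ψ hψ M y) := by
  have h : comparison φ ψ hψ N ∘ₗ balancedMap ψ (f.restrictScalars R) =
      (balancedMap φ f).restrictScalars E ∘ₗ comparison φ ψ hψ M :=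
    balanced_hom_ext_oneTmul ψ fun m => by
      rw [LinearMap.comp_apply, LinearMap.comp_apply, LinearMap.restrictScalars_apply,
        balancedMap_oneTmul, comparison_oneTmul, comparison_oneTmul, balancedMap_oneTmul,
        LinearMap.restrictScalars_apply]
  exact LinearMap.congr_fun h y

variable (M) in
theorem range_comparison :
    LinearMap.range (comparison φ ψ hψ M) = Submodule.span E (Set.range (oneTmul φ M)) := by
  rw [LinearMap.range_eq_map, ← span_range_oneTmul, Submodule.map_span, ← Set.range_comp]
  exact congrArg (Submodule.span E <| Set.range ·) (funext (comparison_oneTmul φ ψ hψ))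

variable (M) in
theorem span_range_comparison :
    Submodule.span D (LinearMap.range (comparison φ ψ hψ M) : Set (BalancedTensor φ M)) = ⊤ := by
  rw [range_comparison, Submodule.span_span_of_tower, span_range_oneTmul]

theorem SkewCommutes.smul_mem_range_comparison {s : S} (hs : SkewCommutes E (φ s))
    {z : BalancedTensor φ M} (hz : z ∈ LinearMap.range (comparison φ ψ hψ M)) :
    φ s • z ∈ LinearMap.range (comparison φ ψ hψ M) := by
  rw [range_comparison] at hz ⊢
  refine hs.smul_mem_span ?_ hz
  rintro _ ⟨m, rfl⟩
  exact Submodule.subset_span ⟨s • m, oneTmul_smul φ s m⟩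

variable {I J : Type*} {β : Module.Basis J R S}

theorem comparison_injective_of_basis (hβ : LinearIndependent E fun j => φ (β j))
    (c : Module.Basis I S M) :
    Function.Injective (comparison φ ψ hψ M) := by
  have hc := linearIndependent_oneTmul φ c
  have hind := linearIndependent_smul hβ hc
  have himage : (comparison φ ψ hψ M ∘ fun p : J × I => oneTmul ψ M (β.smulTower c p)) =
      fun p => φ (β p.1) • oneTmul φ M (c p.2) := funext fun p => by
    rw [Function.comp_apply, comparison_oneTmul, Module.Basis.smulTower_apply, oneTmul_smul]
  rw [← himage] at hind
  have hdisjoint := Submodule.range_ker_disjoint hind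
  rwa [span_oneTmul_eq_top ψ (β.smulTower c).span_eq, top_disjoint, LinearMap.ker_eq_bot]
    at hdisjoint

theorem comparison_injective (hβ : LinearIndependent E fun j => φ (β j))
    [IsScalarTower R S S] (M : Type max v x) [AddCommGroup M] [Module S M] [Module R M]
    [IsScalarTower R S M] [Module.Projective S M] : Function.Injective (comparison φ ψ hψ M) := by
  obtain ⟨s, hs⟩ := Module.Projective.out (R := S) (P := M)
  have hsplit : Function.Injective (balancedMap ψ (s.restrictScalars R)) := by
    refine Function.LeftInverse.injective
      (g := balancedMap ψ ((Finsupp.linearCombination S id).restrictScalars R)) fun y => ?_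
    refine LinearMap.congr_fun (g := LinearMap.id) (f := balancedMap ψ _ ∘ₗ balancedMap ψ _)
      (balanced_hom_ext_oneTmul ψ fun m => ?_) y
    exact congrArg (oneTmul ψ M) (hs m)
  have hfree := comparison_injective_of_basis φ ψ hψ hβ (Module.Basis.ofRepr (.refl S (M →₀ S)))
  have hcomp : Function.Injective (balancedMap φ s ∘ comparison φ ψ hψ M) := by
    convert hfree.comp hsplit using 1
    exact funext fun y => (comparison_balancedMap φ ψ hψ s y).symm
  exact hcomp.of_comp

end Comparison

section Exactness

theorem exists_linearCombination_mem_of_finite_quotient {E V I : Type*} [Ring E]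
    [StrongRankCondition E] [AddCommGroup V] [Module E V] [Infinite I] {Z B : Submodule E V}
    [Module.Finite E (Z ⧸ B.submoduleOf Z)] {c : I → V} (hc : ∀ i, c i ∈ Z) :
    ∃ q : I →₀ E, q ≠ 0 ∧ Finsupp.linearCombination E c q ∈ B := by
  let c' : I → Z := fun i => ⟨c i, hc i⟩
  have hdep := Module.Finite.not_linearIndependent_of_infinite (R := E)
    ((B.submoduleOf Z).mkQ ∘ c')
  rw [linearIndependent_iff] at hdep
  push Not at hdep
  obtain ⟨q, hq, hne⟩ := hdep
  rw [← Finsupp.apply_linearCombination, Submodule.mkQ_apply, Submodule.Quotient.mk_eq_zero]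
    at hq
  refine ⟨q, hne, ?_⟩
  have himage := Finsupp.apply_linearCombination E Z.subtype c' q
  change _ = Finsupp.linearCombination E c q at himage
  rw [← himage]
  exact hq

variable {R : Type u} {S : Type v} {D : Type w} [Ring R] [Ring S] [DivisionRing D]
  [Module R S] [IsScalarTower R S S] {E : Subfield D} (φ : S →+* D) (ψ : R →+* E)
  {J : Type*} {β : Module.Basis J R S}
  {M₁ M₂ M₃ : Type max v x} [AddCommGroup M₁] [AddCommGroup M₂] [AddCommGroup M₃]
  [Module S M₁] [Module S M₂] [Module S M₃] [Module R M₁] [Module R M₂] [Module R M₃]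
  [IsScalarTower R S M₁] [IsScalarTower R S M₂] [IsScalarTower R S M₃] [Module.Projective S M₃]

theorem ker_balancedMap_le_range_of_finite (hψ : ∀ r : R, (ψ r : D) = φ (r • (1 : S)))
    (hβ : LinearIndependent E fun j => φ (β j)) {s : S}
    (hs : IsSkewLaurentFractionField E (φ s)) (f : M₁ →ₗ[S] M₂) (g : M₂ →ₗ[S] M₃)
    (hfin : Module.Finite E (LinearMap.ker (balancedMap ψ (g.restrictScalars R)) ⧸
      (LinearMap.range (balancedMap ψ (f.restrictScalars R))).submoduleOf
        (LinearMap.ker (balancedMap ψ (g.restrictScalars R))))) :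
    LinearMap.ker (balancedMap φ g) ≤ LinearMap.range (balancedMap φ f) := by
  set κ := comparison φ ψ hψ M₂
  intro z hz
  have hstable (y) (hy : y ∈ LinearMap.range κ) : φ s • y ∈ LinearMap.range κ :=
    hs.skewCommutes.smul_mem_range_comparison φ ψ hψ hy
  obtain ⟨a, ha, haz⟩ := hs.exists_smul_mem hstable (span_range_comparison φ ψ hψ M₂) z
  have hlift (n : ℕ) : φ s ^ n • a • z ∈ LinearMap.range κ :=
    smul_mem_of_mem_span_pow hstable (Submodule.subset_span ⟨n, rfl⟩) haz
  choose c hc using hlift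
  have hcycle (n : ℕ) : c n ∈ LinearMap.ker (balancedMap ψ (g.restrictScalars R)) := by
    rw [LinearMap.mem_ker]
    apply comparison_injective φ ψ hψ hβ M₃
    rw [comparison_balancedMap, hc, map_smul, map_smul, LinearMap.mem_ker.1 hz, smul_zero,
      smul_zero, map_zero]
  obtain ⟨q, hq, y, hy⟩ := exists_linearCombination_mem_of_finite_quotient
    (B := LinearMap.range (balancedMap ψ (f.restrictScalars R))) hcycle
  let d := Finsupp.linearCombination E (fun n => φ s ^ n) q
  have hd : d ≠ 0 := fun h => hq (linearIndependent_iff.1 hs.linearIndependent_pow q h)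
  have hboundary : balancedMap φ f (comparison φ ψ hψ M₁ y) = d • a • z := by
    rw [← comparison_balancedMap, hy, Finsupp.linearCombination_apply, map_finsuppSum,
      Finsupp.sum, show d = _ from Finsupp.linearCombination_apply .., Finsupp.sum,
      Finset.sum_smul]
    exact Finset.sum_congr rfl fun n _ => by rw [map_smul, hc, smul_assoc]
  refine ⟨a⁻¹ • d⁻¹ • comparison φ ψ hψ M₁ y, ?_⟩
  rw [map_smul, map_smul, hboundary, inv_smul_smul₀ hd, inv_smul_smul₀ ha]

end Exactness

section Derived

theorem finite_ker_quotient_range {E : Type*} [Ring E] (T : ShortComplex (ModuleCat.{x} E))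
    [Module.Finite E T.homology] :
    Module.Finite E (LinearMap.ker T.g.hom ⧸
      (LinearMap.range T.f.hom).submoduleOf (LinearMap.ker T.g.hom)) := by
  have hrange : LinearMap.range T.moduleCatToCycles =
      (LinearMap.range T.f.hom).submoduleOf (LinearMap.ker T.g.hom) :=
    LinearMap.range_codRestrict ..
  rw [← hrange]
  exact Module.Finite.equiv T.moduleCatHomologyIso.toLinearEquiv

variable {R S : Type u} [Ring R] [Ring S] (f : R →+* S)

instance restrictScalars_preservesHomology :
    (ModuleCat.restrictScalars.{x} f).PreservesHomology := by
  refine ((Functor.exact_tfae (ModuleCat.restrictScalars.{x} f)).out 1 2).mp fun T hT => ?_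
  rw [ShortComplex.ShortExact.moduleCat_exact_iff_function_exact] at hT ⊢
  exact hT

variable [Module R S] [IsScalarTower R S S]

theorem projective_restrictScalars [Module.Free R S] (M : Type x) [AddCommGroup M] [Module S M]
    [Module R M] [IsScalarTower R S M] [Module.Projective S M] : Module.Projective R M := by
  obtain ⟨s, hs⟩ := Module.Projective.out (R := S) (P := M)
  exact .of_split (s.restrictScalars R)
    ((Finsupp.linearCombination S (id : M → M)).restrictScalars R) (LinearMap.ext hs)

variable {f} (hf : ∀ r : R, r • (1 : S) = f r)
include hf

theorem isScalarTower_compHom (M : Type x) [AddCommGroup M] [Module S M] :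
    letI := Module.compHom M f
    IsScalarTower R S M :=
  letI := Module.compHom M f
  ⟨fun r s m => by rw [← smul_one_mul r s, hf, mul_smul]; rfl⟩

theorem restrictScalars_preservesProjectiveObjects [Module.Free R S] :
    (ModuleCat.restrictScalars.{max u x} f).PreservesProjectiveObjects where
  projective_obj {M} hM := by
    have : Module.Projective S M := ModuleCat.projective_of_module_projective M
    let _ : Module R M := Module.compHom M f
    have : IsScalarTower R S M := isScalarTower_compHom hf M
    have hR : Module.Projective R M := projective_restrictScalars (S := S) M
    have : Module.Projective R ((ModuleCat.restrictScalars f).obj M) := hR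
    exact ModuleCat.projective_of_categoryTheory_projective _

variable {D : Type w} [DivisionRing D] {E : Subfield D} {φ : S →+* D} {ψ : R →+* E}
  (hψ : ∀ r : R, (ψ r : D) = φ (f r)) {J : Type*} (β : Module.Basis J R S)
  (hβ : LinearIndependent E fun j => φ (β j)) {s : S} (hs : IsSkewLaurentFractionField E (φ s))
include hψ hβ hs

theorem exact_map_tensorFunctor_of_finite (T : ShortComplex (ModuleCat.{max u x} S))
    [Module.Projective S T.X₃]
    [Module.Finite E ((T.map (ModuleCat.restrictScalars f)).map (tensorFunctor ψ)).homology] :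
    (T.map (tensorFunctor φ)).Exact := by
  let _ (M : Type max u x) [AddCommGroup M] [Module S M] : Module R M := Module.compHom M f
  have := isScalarTower_compHom hf T.X₁
  have := isScalarTower_compHom hf T.X₂
  have := isScalarTower_compHom hf T.X₃
  rw [ShortComplex.moduleCat_exact_iff_ker_sub_range]
  exact ker_balancedMap_le_range_of_finite φ ψ (fun r => by rw [hψ, hf]) hβ hs T.f.hom T.g.hom
    (finite_ker_quotient_range ((T.map (ModuleCat.restrictScalars f)).map (tensorFunctor ψ)))

theorem isZero_leftDerived_tensorFunctor_of_finite (M : ModuleCat.{max u x} S) (p : ℕ)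
    [Module.Finite E (((tensorFunctor ψ).leftDerived p).obj
      ((ModuleCat.restrictScalars f).obj M))] :
    Limits.IsZero (((tensorFunctor φ).leftDerived p).obj M) := by
  have := Module.Free.of_basis β
  have := restrictScalars_preservesProjectiveObjects.{u, x} hf
  let P : ProjectiveResolution M := projectiveResolution M
  let T := P.complex.sc p
  have hfinite : Module.Finite E
      ((T.map (ModuleCat.restrictScalars f)).map (tensorFunctor ψ)).homology :=
    Module.Finite.equiv (((ModuleCat.restrictScalars f).mapProjectiveResolution P).isoLeftDerivedObj
      (tensorFunctor ψ) p).toLinearEquiv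
  have hprojective : Module.Projective S T.X₃ :=
    have := P.projective ((ComplexShape.down ℕ).next p)
    ModuleCat.projective_of_module_projective (P.complex.X ((ComplexShape.down ℕ).next p))
  have hexact := exact_map_tensorFunctor_of_finite hf hψ β hβ hs T
  exact ((ShortComplex.exact_iff_isZero_homology _).1 hexact).of_iso
    (P.isoLeftDerivedObj (tensorFunctor φ) p)

end Derived

section Generated

variable {F : Type u} {G : Type v} {D : Type w} [DivisionRing F] [Group G] [DivisionRing D]
  {φ : MonoidAlgebra F G →+* D}

theorem generated_le_iff {E : Subfield D} :
    generated φ ≤ E ↔ ∀ g a, φ (MonoidAlgebra.single g a) ∈ E := by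
  refine ⟨fun h g a => h (Subfield.subset_closure ⟨_, rfl⟩), fun h => Subfield.closure_le.2 ?_⟩
  rintro _ ⟨z, rfl⟩
  induction z using MonoidAlgebra.induction_linear with
  | zero => rw [map_zero]; exact E.zero_mem
  | add y z hy hz => rw [map_add]; exact E.add_mem hy hz
  | single g a => exact h g a

theorem map_single_mem_generated (φ : MonoidAlgebra F G →+* D) (g : G) (a : F) :
    φ (MonoidAlgebra.single g a) ∈ generated φ :=
  generated_le_iff.1 le_rfl g a

theorem map_of_ne_zero (φ : MonoidAlgebra F G →+* D) (g : G) : φ (MonoidAlgebra.of F G g) ≠ 0 :=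
  (((Group.isUnit g).map (MonoidAlgebra.of F G)).map φ).ne_zero

theorem map_zpow_eq_ofAdd {π : G →* Multiplicative ℤ} {t : G} (ht : π t = Multiplicative.ofAdd 1)
    (n : ℤ) : π (t ^ n) = Multiplicative.ofAdd n := by
  rw [map_zpow, ht, ← ofAdd_zsmul, zsmul_one, Int.cast_id]

theorem map_of_zpow (φ : MonoidAlgebra F G →+* D) (g : G) (n : ℤ) :
    φ (MonoidAlgebra.of F G (g ^ n)) = φ (MonoidAlgebra.of F G g) ^ n :=
  map_zpow (φ.toMonoidHom.comp (MonoidAlgebra.of F G)) g n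

variable {K : Type*} [Group K] {ι : K →* G} {L : Type*} [Group L] {κ : L →* G}

theorem restrict_single (φ : MonoidAlgebra F G →+* D) (ι : K →* G) (k : K) (a : F) :
    restrict φ ι (MonoidAlgebra.single k a) = φ (MonoidAlgebra.single (ι k) a) := by
  rw [restrict, RingHom.comp_apply, MonoidAlgebra.mapDomainRingHom_apply,
    MonoidAlgebra.mapDomain_single]

theorem map_single_mem_generated_restrict {g : G} (hg : g ∈ ι.range) (a : F) :
    φ (MonoidAlgebra.single g a) ∈ generated (restrict φ ι) := by
  obtain ⟨k, rfl⟩ := hg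
  rw [← restrict_single]
  exact map_single_mem_generated _ k a

theorem generated_restrict_le_iff {E : Subfield D} :
    generated (restrict φ ι) ≤ E ↔ ∀ g ∈ ι.range, ∀ a, φ (MonoidAlgebra.single g a) ∈ E := by
  simp only [generated_le_iff, restrict_single, MonoidHom.mem_range, forall_exists_index,
    forall_apply_eq_imp_iff]

theorem generated_restrict_mono (h : ι.range ≤ κ.range) :
    generated (restrict φ ι) ≤ generated (restrict φ κ) :=
  generated_restrict_le_iff.2 fun _ hg => map_single_mem_generated_restrict (h hg)

theorem exists_fg_mem_generated_restrict {d : D} (hd : d ∈ generated (restrict φ ι)) :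
    ∃ H : Subgroup G, H.FG ∧ H ≤ ι.range ∧ d ∈ generated (restrict φ H.subtype) := by
  let Fg := {H : Subgroup G // H.FG ∧ H ≤ ι.range}
  have : Nonempty Fg := ⟨⊥, Subgroup.FG.bot, bot_le⟩
  have hdirected : Directed (· ≤ ·) fun H : Fg => generated (restrict φ H.1.subtype) := by
    refine fun H H' => ⟨⟨H ⊔ H', H.2.1.sup H'.2.1, sup_le H.2.2 H'.2.2⟩, ?_, ?_⟩ <;>
      refine generated_restrict_mono ?_ <;> simp only [Subgroup.range_subtype]
    exacts [le_sup_left, le_sup_right]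
  have hle : generated (restrict φ ι) ≤ ⨆ H : Fg, generated (restrict φ H.1.subtype) := by
    refine generated_restrict_le_iff.2 fun g hg a => ?_
    let H : Fg := ⟨Subgroup.closure {g}, ⟨{g}, by rw [Finset.coe_singleton]⟩,
      (Subgroup.closure_le _).2 (Set.singleton_subset_iff.2 hg)⟩
    refine le_iSup (fun H : Fg => generated (restrict φ H.1.subtype)) H ?_
    refine map_single_mem_generated_restrict ?_ a
    rw [Subgroup.range_subtype]
    exact Subgroup.subset_closure rfl
  obtain ⟨⟨H, hfg, hι⟩, hH⟩ := (Subfield.mem_iSup_of_directed hdirected).1 (hle hd)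
  exact ⟨H, hfg, hι, hH⟩

theorem exists_fg_forall_mem_generated_restrict {J : Type*} [Finite J] {c : J → D}
    (hc : ∀ j, c j ∈ generated (restrict φ ι)) :
    ∃ H : Subgroup G, H.FG ∧ H ≤ ι.range ∧ ∀ j, c j ∈ generated (restrict φ H.subtype) := by
  choose H hfg hι hcH using fun j => exists_fg_mem_generated_restrict (hc j)
  refine ⟨⨆ j, H j, Subgroup.FG.iSup H hfg, iSup_le hι, fun j => ?_⟩
  refine generated_restrict_mono ?_ (hcH j)
  simp only [Subgroup.range_subtype]
  exact le_iSup H j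

theorem skewCommutes_generated_restrict (hι : ι.range.Normal) (g : G) :
    SkewCommutes (generated (restrict φ ι)) (φ (MonoidAlgebra.of F G g)) := by
  set γ : Dˣ := Units.mk0 _ (map_of_ne_zero φ g)
  let conj := MulSemiringAction.toRingHom (ConjAct Dˣ) D (ConjAct.toConjAct γ)
  have hconj (d : D) : conj d = (γ : D) * d * (γ : D)⁻¹ := by
    rw [MulSemiringAction.toRingHom_apply, ConjAct.units_smul_def, ConjAct.ofConjAct_toConjAct,
      Units.val_inv_eq_inv_val]
  have hle : generated (restrict φ ι) ≤ (generated (restrict φ ι)).comap conj := by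
    refine generated_restrict_le_iff.2 fun k hk a => ?_
    have hsingle : conj (φ (MonoidAlgebra.single k a)) =
        φ (MonoidAlgebra.single (g * k * g⁻¹) a) := by
      rw [hconj, mul_inv_eq_iff_eq_mul₀ γ.ne_zero, Units.val_mk0, ← map_mul, ← map_mul,
        MonoidAlgebra.of_apply, MonoidAlgebra.single_mul_single, MonoidAlgebra.single_mul_single,
        inv_mul_cancel_right, one_mul, mul_one]
    rw [Subfield.mem_comap, hsingle]
    exact map_single_mem_generated_restrict (hι.conj_mem k hk g) a
  refine fun e he => ⟨conj e, hle he, ?_⟩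
  rw [hconj]
  exact (inv_mul_cancel_right₀ γ.ne_zero _).symm

theorem IsHughesFree.linearIndependent_of_fg (hφ : IsHughesFree φ) {H : Subgroup G} (hH : H.FG)
    {ρ : H →* Multiplicative ℤ} (hρ : Function.Surjective ρ) {J : Type*} {x : J → H}
    (hx : Function.Injective (ρ ∘ x)) :
    LinearIndependent (generated (HughesFree.restrict φ (H.subtype.comp ρ.ker.subtype)))
      fun j => φ (MonoidAlgebra.of F G (x j)) := by
  have hne : H ≠ ⊥ := by
    rintro rfl
    exact not_subsingleton (Multiplicative ℤ) hρ.subsingleton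
  rw [linearIndependent_iff']
  intro s c hsum j hj
  let e := s.equivFin
  have hcosets : Function.Injective fun i => (x (e.symm i) : H ⧸ ρ.ker) := fun i i' h =>
    e.symm.injective <| Subtype.ext <| hx <| congrArg (QuotientGroup.kerLift ρ) h
  have hsum' : ∑ i, (c (e.symm i) : D) * φ (MonoidAlgebra.of F G (x (e.symm i))) = 0 := by
    rw [e.symm.sum_comp fun j : s => (c j : D) * φ (MonoidAlgebra.of F G (x j)),
      Finset.sum_coe_sort s fun j => (c j : D) * φ (MonoidAlgebra.of F G (x j))]
    exact hsum
  have hterm := hφ.direct H hH hne ρ.ker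
    ⟨QuotientGroup.quotientKerEquivOfSurjective ρ hρ⟩ s.card _ hcosets _
    (fun i => (c (e.symm i)).2) hsum' (e ⟨j, hj⟩)
  rw [e.symm_apply_apply] at hterm
  exact Subtype.ext ((mul_eq_zero.1 hterm).resolve_right (map_of_ne_zero φ _))

theorem IsHughesFree.linearIndependent (hφ : IsHughesFree φ) {π : G →* Multiplicative ℤ}
    (hπ : Function.Surjective π) (hexact : ι.range = π.ker) {J : Type*} {x : J → G}
    (hx : Function.Injective (π ∘ x)) :
    LinearIndependent (generated (HughesFree.restrict φ ι))
      fun j => φ (MonoidAlgebra.of F G (x j)) := by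
  classical
  obtain ⟨t, ht⟩ := hπ (Multiplicative.ofAdd 1)
  rw [linearIndependent_iff_finset_linearIndependent]
  intro s
  rw [Fintype.linearIndependent_iff]
  intro c hsum j
  obtain ⟨N, hNfg, hNι, hcN⟩ := exists_fg_forall_mem_generated_restrict fun j : s => (c j).2
  let S : Finset G := insert t (s.image x)
  let H : Subgroup G := Subgroup.closure S ⊔ N
  have hSH {g : G} (hg : g ∈ S) : g ∈ H :=
    le_sup_left (a := Subgroup.closure (S : Set G)) (Subgroup.subset_closure hg)
  have hxH (j : s) : x j ∈ H :=
    hSH (Finset.mem_insert_of_mem (Finset.mem_image_of_mem x j.2))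
  let ρ : H →* Multiplicative ℤ := π.comp H.subtype
  have hρ : Function.Surjective ρ := fun n =>
    ⟨⟨t, hSH (Finset.mem_insert_self _ _)⟩ ^ n.toAdd, map_zpow_eq_ofAdd (π := ρ) ht _⟩
  have hcH (j : s) :
      (c j : D) ∈ generated (HughesFree.restrict φ (H.subtype.comp ρ.ker.subtype)) := by
    refine generated_restrict_mono (fun n hn => ?_) (hcN j)
    rw [Subgroup.range_subtype] at hn
    have hker : n ∈ π.ker := hexact.le (hNι hn)
    exact ⟨⟨⟨n, le_sup_right (b := N) hn⟩, hker⟩, rfl⟩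
  have hind := hφ.linearIndependent_of_fg (Subgroup.FG.sup ⟨S, rfl⟩ hNfg) hρ
    (x := fun j : s => ⟨x j, hxH j⟩) fun i j h => Subtype.ext (hx h)
  have hzero := Fintype.linearIndependent_iff.1 hind (fun j => ⟨c j, hcH j⟩) hsum j
  exact Subtype.ext (show (c j : D) = 0 from congrArg Subtype.val hzero)

theorem IsHughesFree.linearIndependent_zpow (hφ : IsHughesFree φ) {π : G →* Multiplicative ℤ}
    {t : G} (hexact : ι.range = π.ker) (ht : π t = Multiplicative.ofAdd 1) :
    LinearIndependent (generated (HughesFree.restrict φ ι))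
      fun n : ℤ => φ (MonoidAlgebra.of F G t) ^ n := by
  have hπt (n : ℤ) : π (t ^ n) = Multiplicative.ofAdd n := map_zpow_eq_ofAdd ht n
  have hπ : Function.Surjective π := fun n => ⟨t ^ n.toAdd, hπt _⟩
  have hinj : Function.Injective (π ∘ fun n : ℤ => t ^ n) := fun m n h => by
    simpa only [Function.comp_apply, hπt, EmbeddingLike.apply_eq_iff_eq] using h
  simpa only [map_of_zpow] using hφ.linearIndependent hπ hexact hinj

end Generated

section Betti

variable {F : Type u} {G : Type v} {D : Type w} [DivisionRing F] [Group G] [DivisionRing D]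
  {φ : MonoidAlgebra F G →+* D} {p : ℕ}

theorem betti_lt_top_iff : betti φ p < ⊤ ↔ Module.Finite D (homology φ p) := by
  rw [betti, Cardinal.toENat_lt_top, Module.rank_lt_aleph0_iff]

theorem betti_eq_zero_iff : betti φ p = 0 ↔ Limits.IsZero (homology φ p) := by
  rw [betti, Cardinal.toENat_eq_zero, rank_zero_iff, ModuleCat.isZero_iff_subsingleton]

end Betti

section Transversal

variable {F : Type u} {G : Type v} {K : Type w} [Ring F] [Group G] [Group K] {ι : K →* G}

theorem bijective_mul_zpow {π : G →* Multiplicative ℤ} {t : G} (hι : Function.Injective ι)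
    (hexact : ι.range = π.ker) (ht : π t = Multiplicative.ofAdd 1) :
    Function.Bijective fun q : K × ℤ => ι q.1 * t ^ q.2 := by
  have hπι (k : K) : π (ι k) = 1 := MonoidHom.mem_ker.1 (hexact.le ⟨k, rfl⟩)
  constructor
  · rintro ⟨k, m⟩ ⟨l, n⟩ (h : ι k * t ^ m = ι l * t ^ n)
    have hmn := congrArg π h
    rw [map_mul, map_mul, hπι, hπι, map_zpow_eq_ofAdd ht,
      map_zpow_eq_ofAdd ht, one_mul, one_mul] at hmn
    obtain rfl : m = n := Multiplicative.ofAdd.injective hmn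
    rw [hι (mul_right_cancel h)]
  · intro g
    have hker : g * (t ^ (π g).toAdd)⁻¹ ∈ π.ker := by
      rw [MonoidHom.mem_ker, map_mul, map_inv, map_zpow_eq_ofAdd ht, ofAdd_toAdd, mul_inv_cancel]
    obtain ⟨k, hk⟩ := hexact.ge hker
    exact ⟨(k, (π g).toAdd), (congrArg (· * _) hk).trans (inv_mul_cancel_right _ _)⟩

variable {J : Type*} {x : J → G}

theorem coeff_mapDomain_mul_of [DecidableEq J]
    (hx : Function.Injective fun q : K × J => ι q.1 * x q.2)
    (r : MonoidAlgebra F K) (i j : J) (k : K) :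
    (MonoidAlgebra.mapDomainRingHom F ι r * MonoidAlgebra.of F G (x i)).coeff (ι k * x j) =
      if i = j then r.coeff k else 0 := by
  have hι : Function.Injective ι := fun k l h =>
    congrArg Prod.fst (hx (a₁ := (k, i)) (a₂ := (l, i)) (congrArg (· * x i) h))
  rw [MonoidAlgebra.of_apply, MonoidAlgebra.coeff_mul_single_apply, mul_one,
    MonoidAlgebra.mapDomainRingHom_apply, MonoidAlgebra.coeff_mapDomain]
  split_ifs with hij
  · rw [hij, mul_inv_cancel_right, Finsupp.mapDomain_apply hι]
  · refine Finsupp.mapDomain_of_notMem_range _ _ ?_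
    rintro ⟨l, hl⟩
    exact hij (congrArg Prod.snd (hx (a₁ := (l, i)) (a₂ := (k, j)) (eq_mul_inv_iff_mul_eq.1 hl)))

variable (F)

theorem exists_basis_of_transversal (hx : Function.Bijective fun q : K × J => ι q.1 * x q.2) :
    letI : Module (MonoidAlgebra F K) (MonoidAlgebra F G) :=
      Module.compHom _ (MonoidAlgebra.mapDomainRingHom F ι)
    ∃ β : Module.Basis J (MonoidAlgebra F K) (MonoidAlgebra F G),
      ∀ j, β j = MonoidAlgebra.of F G (x j) := by
  classical
  let _ : Module (MonoidAlgebra F K) (MonoidAlgebra F G) :=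
    Module.compHom _ (MonoidAlgebra.mapDomainRingHom F ι)
  have hsmul (r : MonoidAlgebra F K) (s : MonoidAlgebra F G) :
      r • s = MonoidAlgebra.mapDomainRingHom F ι r * s := rfl
  have hind : LinearIndependent (MonoidAlgebra F K) fun j => MonoidAlgebra.of F G (x j) := by
    rw [linearIndependent_iff']
    intro s c hc j hj
    ext k
    have hcoeff := congrArg (fun z : MonoidAlgebra F G => z.coeff (ι k * x j)) hc
    simpa only [hsmul, MonoidAlgebra.coeff_sum, Finsupp.finsetSum_apply,
      coeff_mapDomain_mul_of hx.injective, Finset.sum_ite_eq', hj, if_true,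
      MonoidAlgebra.coeff_zero, Finsupp.zero_apply] using hcoeff
  have hspan : ⊤ ≤ Submodule.span (MonoidAlgebra F K)
      (Set.range fun j => MonoidAlgebra.of F G (x j)) := by
    rintro z -
    induction z using MonoidAlgebra.induction_linear with
    | zero => exact Submodule.zero_mem _
    | add y z hy hz => exact Submodule.add_mem _ hy hz
    | single g a =>
      obtain ⟨⟨k, j⟩, rfl⟩ := hx.surjective g
      have hsingle : MonoidAlgebra.single (ι k * x j) a =
          (MonoidAlgebra.single k a : MonoidAlgebra F K) • MonoidAlgebra.of F G (x j) := by
        rw [hsmul, MonoidAlgebra.mapDomainRingHom_apply, MonoidAlgebra.mapDomain_single,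
          MonoidAlgebra.of_apply, MonoidAlgebra.single_mul_single, mul_one]
      rw [hsingle]
      exact Submodule.smul_mem _ _ (Submodule.subset_span ⟨j, rfl⟩)
  exact ⟨.mk hind hspan, Module.Basis.mk_apply hind hspan⟩

end Transversal

section Extension

variable {F : Type u} {G K : Type v} {D : Type w} [DivisionRing F] [Group G] [Group K]
  [DivisionRing D]

variable (F) in
theorem augmentation_comp_mapDomainRingHom (ι : K →* G) :
    (augmentation F G).comp (MonoidAlgebra.mapDomainRingHom F ι) = augmentation F K := by
  refine MonoidAlgebra.ringHom_ext (fun a => ?_) fun k => ?_ <;> simp [augmentation]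

variable (F) in
/-- The restriction to `F[K]` of the trivial `F[G]`-module is the trivial `F[K]`-module; the
isomorphism is the identity on underlying groups. -/
def restrictTrivialModule (ι : K →* G) :
    (ModuleCat.restrictScalars (MonoidAlgebra.mapDomainRingHom F ι)).obj (trivialModule F G) ≅
      trivialModule F K :=
  let e : (ModuleCat.restrictScalars (MonoidAlgebra.mapDomainRingHom F ι)).obj
      (trivialModule F G) ≃ₗ[MonoidAlgebra F K] trivialModule F K :=
    { AddEquiv.refl (ULift.{v} F) with
      map_smul' := fun r y =>
        congrArg (fun h : MonoidAlgebra F K →+* F => h r • (show ULift.{v} F from y))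
          (augmentation_comp_mapDomainRingHom F ι) }
  e.toModuleIso

theorem isSkewLaurentFractionField_generated_restrict {φ : MonoidAlgebra F G →+* D}
    (hφ : generated φ = ⊤) {ι : K →* G} {t : G} (hι : ι.range.Normal)
    (ht : Function.Surjective fun q : K × ℤ => ι q.1 * t ^ q.2)
    (hind : LinearIndependent (generated (restrict φ ι))
      fun n : ℤ => φ (MonoidAlgebra.of F G t) ^ n) :
    IsSkewLaurentFractionField (generated (restrict φ ι)) (φ (MonoidAlgebra.of F G t)) where
  skewCommutes := skewCommutes_generated_restrict hι t
  linearIndependent_zpow := hind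
  closure_eq_top := by
    rw [← top_le_iff, ← hφ, generated_le_iff]
    intro g a
    obtain ⟨⟨k, n⟩, rfl⟩ := ht g
    have hsplit : φ (MonoidAlgebra.single (ι k * t ^ n) a) =
        φ (MonoidAlgebra.single (ι k) a) * φ (MonoidAlgebra.of F G t) ^ n := by
      rw [← map_of_zpow, ← map_mul, MonoidAlgebra.of_apply, MonoidAlgebra.single_mul_single,
        mul_one]
    rw [hsplit]
    exact mul_mem
      (Subfield.subset_closure (Set.mem_insert_of_mem _
        (map_single_mem_generated_restrict ⟨k, rfl⟩ a)))
      (zpow_mem (Subfield.subset_closure (Set.mem_insert _ _)) n)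

end Extension

end HughesFree

end

theorem mainTheorem6_general {F : Type u} {G K : Type v} {D : Type w}
    [DivisionRing F] [Group G] [Group K] [DivisionRing D]
    (φ : MonoidAlgebra F G →+* D) (hφ : HughesFree.generated φ = ⊤)
    (ι : K →* G) (π : G →* Multiplicative ℤ) (t : G)
    (hι : Function.Injective ι) (hexact : ι.range = π.ker) (ht : π t = Multiplicative.ofAdd 1)
    (hind : LinearIndependent (HughesFree.generated (HughesFree.restrict φ ι))
      fun n : ℤ => φ (MonoidAlgebra.of F G t) ^ n)
    (p : ℕ)
    (hfin : HughesFree.betti (HughesFree.toGenerated (HughesFree.restrict φ ι)) p < ⊤) :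
    HughesFree.betti φ p = 0 := by
  open HughesFree in
  let f := MonoidAlgebra.mapDomainRingHom F ι
  let ψ := toGenerated (restrict φ ι)
  let _ : Module (MonoidAlgebra F K) (MonoidAlgebra F G) := Module.compHom _ f
  have : IsScalarTower (MonoidAlgebra F K) (MonoidAlgebra F G) (MonoidAlgebra F G) :=
    ⟨fun r => mul_assoc (f r)⟩
  have htransversal := bijective_mul_zpow hι hexact ht
  have hfield := isSkewLaurentFractionField_generated_restrict hφ (hexact ▸ π.normal_ker)
    htransversal.surjective hind
  obtain ⟨β, hβ⟩ := exists_basis_of_transversal F htransversal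
  have hβind : LinearIndependent (generated (restrict φ ι)) fun n => φ (β n) := by
    simpa only [hβ, map_of_zpow] using hind
  have hK : Module.Finite (generated (restrict φ ι)) (homology ψ p) := betti_lt_top_iff.1 hfin
  let e : homology ψ p ≅ ((tensorFunctor.{max u v, w, max u v} ψ).leftDerived p).obj
      ((ModuleCat.restrictScalars f).obj (trivialModule F G)) :=
    ((tensorFunctor ψ).leftDerived p).mapIso (restrictTrivialModule F ι).symm
  have := Module.Finite.equiv e.toLinearEquiv
  exact betti_eq_zero_iff.2 <| isZero_leftDerived_tensorFunctor_of_finite (f := f) (ψ := ψ)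
    (fun r => mul_one (f r)) (fun _ => rfl) β hβind hfield (trivialModule F G) p

theorem mainTheorem6 {F : Type u} {G K : Type v} {D : Type w}
    [DivisionRing F] [Group G] [Group K] [DivisionRing D]
    (hG : HughesFree.LocallyIndicable G)
    (φ : MonoidAlgebra F G →+* D) (hφ : HughesFree.IsHughesFree φ)
    (ι : K →* G) (π : G →* Multiplicative ℤ)
    (hι : Function.Injective ι) (hexact : ι.range = π.ker) (hπ : Function.Surjective π)
    (p : ℕ)
    (hfin : HughesFree.betti (HughesFree.toGenerated (HughesFree.restrict φ ι)) p < ⊤) :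
    HughesFree.betti φ p = 0 := by
  obtain ⟨t, ht⟩ := hπ (Multiplicative.ofAdd 1)
  exact mainTheorem6_general φ hφ.generated_eq_top ι π t hι hexact ht
    (hφ.linearIndependent_zpow hexact ht) p hfin
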